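/- Let $E$ be an entire function of the Hermite–Biehler class, i.e. $|E(\bar z)|<|E(z)|$ for all $z\in\mathbb C_+=\{\Im z>0\}$, and write $f^{\#}(z)=\overline{f(\bar z)}$. Let $H(E)$ be the de Branges space of all entire functions $f$ such that $f/E$ and $f^{\#}/E$ belong to the Hardy space $H^2(\mathbb C_+)$, with inner product $\langle f,g\rangle=\int_{-\infty}^{\infty} f(t)\overline{g(t)}\,|E(t)|^{-2}\,dt$. Let $\varphi$ be an entire function such that the composition operator $C_\varphi f=f\circ\varphi$ is a bounded operator from $H(E)$ to itself. Put $A=(E+E^{\#})/2$, suppose that $A$ has infinitely many real zeros at which $E$ does not vanish (if $E$ has no real zeros, these are all the zeros of $A$), and let $(t_n)_{n\ge 0}$ be an enumeration of them without repetition. Put $$ r_n=\begin{cases} \dfrac{|E(\varphi(t_n))|^2-|E(\overline{\varphi(t_n)})|^2}{-4i\,\Im(\varphi(t_n))\,E(t_n)\,\Re(E'(t_n))} & \text{if } \varphi(t_n)\notin\mathbb R,\\[3mm] \dfrac{-i\,\Im\bigl(E'(\varphi(t_n))\,\overline{E(\varphi(t_n))}\bigr)}{E(t_n)\,\Re(E'(t_n))}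 & \text{if } \varphi(t_n)\in\mathbb R \end{cases} $$ (these are real numbers, since $E(t_n)$ is purely imaginary). If there is a real number $d>0$ such that $d\le\limsup_{n\to\infty} r_n$, then $C_\varphi$ is not compact on $H(E)$. -/

import Mathlib

open Filter Topology MeasureTheory
open scoped ComplexConjugate NNReal ENNReal

noncomputable section

namespace DeBranges

/-- The Hermite–Biehler class: entire functions with `|E(z̄)| < |E(z)|` on the open upper
half-plane. -/
structure IsHermiteBiehler (E : ℂ → ℂ) : Prop where
  differentiable : Differentiable ℂ E
  norm_conj_lt : ∀ z : ℂ, 0 < z.im → ‖E (conj z)‖ < ‖E z‖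

/-- `f^#(z) = conj (f (conj z))`. -/
def sharp (f : ℂ → ℂ) (z : ℂ) : ℂ := conj (f (conj z))

/-- Membership in the Hardy space `H²` of the open upper half-plane: `F` is holomorphic there and
the integrals of `|F|²` over horizontal lines are uniformly bounded. Only the values of `F` on the
open upper half-plane matter. -/
def MemHardyTwo (F : ℂ → ℂ) : Prop :=
  DifferentiableOn ℂ F {z : ℂ | 0 < z.im} ∧
    ∃ C : ℝ≥0, ∀ y : ℝ, 0 < y → ∫⁻ x : ℝ, ‖F (x + y * Complex.I)‖ₑ ^ 2 ≤ C

lemma MemHardyTwo.add {F G : ℂ → ℂ} (hF : MemHardyTwo F) (hG : MemHardyTwo G) :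
    MemHardyTwo (F + G) := by
  obtain ⟨hF1, C, hC⟩ := hF
  obtain ⟨hG1, D, hD⟩ := hG
  refine ⟨hF1.add hG1, 2 * C + 2 * D, fun y hy => ?_⟩
  have hm : Measurable fun x : ℝ => 2 * ‖F (x + y * Complex.I)‖ₑ ^ 2 := by
    have : Continuous fun x : ℝ => F (x + y * Complex.I) :=
      hF1.continuousOn.comp_continuous (by fun_prop) (fun x => by simpa using hy)
    exact (this.measurable.enorm.pow_const 2).const_mul 2
  have key : ∀ a b : ℂ, ‖a + b‖ₑ ^ 2 ≤ 2 * ‖a‖ₑ ^ 2 + 2 * ‖b‖ₑ ^ 2 := by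
    intro a b
    have h : ‖a + b‖₊ ^ 2 ≤ 2 * ‖a‖₊ ^ 2 + 2 * ‖b‖₊ ^ 2 := by
      rw [← NNReal.coe_le_coe]
      push_cast
      nlinarith [norm_add_le a b, norm_nonneg (a + b), sq_nonneg (‖a‖ - ‖b‖)]
    simp only [enorm_eq_nnnorm]
    exact_mod_cast h
  calc ∫⁻ x : ℝ, ‖(F + G) (x + y * Complex.I)‖ₑ ^ 2
      ≤ ∫⁻ x : ℝ, (2 * ‖F (x + y * Complex.I)‖ₑ ^ 2 + 2 * ‖G (x + y * Complex.I)‖ₑ ^ 2) :=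
        lintegral_mono fun x => key _ _
    _ = 2 * (∫⁻ x : ℝ, ‖F (x + y * Complex.I)‖ₑ ^ 2)
        + 2 * ∫⁻ x : ℝ, ‖G (x + y * Complex.I)‖ₑ ^ 2 := by
        rw [lintegral_add_left hm, lintegral_const_mul' _ _ (by simp),
          lintegral_const_mul' _ _ (by simp)]
    _ ≤ 2 * C + 2 * D := by gcongr; exacts [hC y hy, hD y hy]
    _ = ((2 * C + 2 * D : ℝ≥0) : ℝ≥0∞) := by push_cast; rfl

lemma MemHardyTwo.const_smul {F : ℂ → ℂ} (hF : MemHardyTwo F) (c : ℂ) :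
    MemHardyTwo (c • F) := by
  obtain ⟨hF1, C, hC⟩ := hF
  refine ⟨hF1.const_smul c, ‖c‖₊ ^ 2 * C, fun y hy => ?_⟩
  simp only [Pi.smul_apply, enorm_smul, mul_pow]
  rw [lintegral_const_mul' _ _ (by simp)]
  push_cast
  rw [enorm_eq_nnnorm]
  gcongr
  exact hC y hy

lemma memHardyTwo_zero : MemHardyTwo 0 :=
  ⟨differentiableOn_const 0, 0, fun y _ => by simp⟩

/-- The de Branges space `H(E)` as a linear subspace of the functions on `ℂ`: the entire
functions `f` such that `f / E` and `f^# / E` belong to `H²` of the upper half-plane. -/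
def deBrangesSubmodule (E : ℂ → ℂ) : Submodule ℂ (ℂ → ℂ) where
  carrier := {f | Differentiable ℂ f ∧ MemHardyTwo (fun z => f z / E z) ∧
    MemHardyTwo (fun z => sharp f z / E z)}
  add_mem' := by
    rintro f g ⟨hf, hf1, hf2⟩ ⟨hg, hg1, hg2⟩
    refine ⟨hf.add hg, ?_, ?_⟩
    · convert! hf1.add hg1 using 1
      ext z; simp [add_div]
    · convert! hf2.add hg2 using 1
      ext z; simp [sharp, add_div]
  zero_mem' := by
    refine ⟨differentiable_const 0, ?_, ?_⟩
    · convert! memHardyTwo_zero using 1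
      ext z; simp
    · convert! memHardyTwo_zero using 1
      ext z; simp [sharp]
  smul_mem' := by
    rintro c f ⟨hf, hf1, hf2⟩
    refine ⟨hf.const_smul c, ?_, ?_⟩
    · convert! hf1.const_smul c using 1
      ext z; simp [mul_div_assoc]
    · convert! hf2.const_smul (conj c) using 1
      ext z; simp [sharp, mul_div_assoc]

/-- The de Branges space `H(E)` of a Hermite–Biehler function `E`. It is a separate type, so that
it carries the topology of its own norm and not that of pointwise convergence. -/
def Space (E : ℂ → ℂ) (_hE : IsHermiteBiehler E) : Type := deBrangesSubmodule E

variable {E : ℂ → ℂ} {hE : IsHermiteBiehler E}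

instance : AddCommGroup (Space E hE) := inferInstanceAs (AddCommGroup (deBrangesSubmodule E))

instance : Module ℂ (Space E hE) := inferInstanceAs (Module ℂ (deBrangesSubmodule E))

/-- Elements of `H(E)` are functions on `ℂ`. -/
instance : CoeFun (Space E hE) (fun _ => ℂ → ℂ) := ⟨fun f => Subtype.val f⟩

@[simp] lemma add_apply (f g : Space E hE) (z : ℂ) : (f + g) z = f z + g z := rfl

@[simp] lemma smul_apply (c : ℂ) (f : Space E hE) (z : ℂ) : (c • f) z = c * f z := rfl

@[simp] lemma zero_apply (z : ℂ) : (0 : Space E hE) z = 0 := rfl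

lemma Space.ext {f g : Space E hE} (h : ∀ z, f z = g z) : f = g := Subtype.ext (funext h)

lemma Space.differentiable (f : Space E hE) : Differentiable ℂ f := f.2.1

/-- A nonzero entire function vanishes almost nowhere on the real line. -/
lemma ae_ne_zero {f : ℂ → ℂ} (hf : Differentiable ℂ f) {w : ℂ} (hw : f w ≠ 0) :
    ∀ᵐ t : ℝ, f t ≠ 0 := by
  have han : AnalyticOnNhd ℂ f Set.univ := fun z _ => hf.analyticAt z
  have hg : AnalyticOnNhd ℝ (fun t : ℝ => f t) Set.univ := fun t _ =>
    AnalyticAt.fun_comp (g := f) ((hf.analyticAt (t : ℂ)).restrictScalars (𝕜 := ℝ))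
      (Complex.ofRealCLM.analyticAt t)
  by_cases h : ∃ t : ℝ, f t ≠ 0
  · obtain ⟨t, ht⟩ := h
    have h1 := hg.preimage_zero_mem_codiscrete (x := t) ht
    have h2 := ae_restrict_le_codiscreteWithin (μ := (volume : Measure ℝ)) MeasurableSet.univ h1
    rw [Measure.restrict_univ] at h2
    filter_upwards [h2] with x hx
    simpa using hx
  · push Not at h
    exfalso
    apply hw
    refine han.eqOn_zero_of_preconnected_of_frequently_eq_zero (z₀ := 0) isPreconnected_univ
      trivial ?_ (Set.mem_univ w)
    have ht : Tendsto (fun t : ℝ => (t : ℂ)) (𝓝[≠] 0) (𝓝[≠] 0) := by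
      refine tendsto_nhdsWithin_iff.2 ⟨?_, ?_⟩
      · exact (Complex.continuous_ofReal.tendsto' 0 0 (by simp)).mono_left nhdsWithin_le_nhds
      · filter_upwards [self_mem_nhdsWithin] with t ht
        simpa using ht
    exact ht.frequently (Frequently.of_forall h)

lemma IsHermiteBiehler.ne_zero (hE : IsHermiteBiehler E) {z : ℂ} (hz : 0 < z.im) : E z ≠ 0 :=
  norm_pos_iff.1 ((norm_nonneg _).trans_lt (hE.norm_conj_lt z hz))

lemma IsHermiteBiehler.ae_ne_zero (hE : IsHermiteBiehler E) : ∀ᵐ t : ℝ, E t ≠ 0 :=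
  DeBranges.ae_ne_zero hE.differentiable (hE.ne_zero (z := Complex.I) (by simp))

/-- The restriction of `f / E` to the real line is square integrable. -/
lemma Space.memLp (f : Space E hE) : MemLp (fun t : ℝ => f t / E t) 2 := by
  have hfc : Continuous (f : ℂ → ℂ) := f.differentiable.continuous
  have hEc : Continuous E := hE.differentiable.continuous
  have hmeas : ∀ s : ℂ, Measurable fun t : ℝ => f (t + s) / E (t + s) := by
    intro s
    have h1 := hfc.measurable
    have h2 := hEc.measurable
    fun_prop
  have hm0 : Measurable fun t : ℝ => f t / E t := by simpa using hmeas 0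
  refine ⟨hm0.aestronglyMeasurable, ?_⟩
  obtain ⟨-, C, hC⟩ := f.2.2.1
  rw [eLpNorm_lt_top_iff_lintegral_rpow_enorm_lt_top (by norm_num) (by norm_num)]
  simp only [ENNReal.toReal_ofNat, ENNReal.rpow_ofNat]
  let y : ℕ → ℝ := fun n => 1 / ((n : ℝ) + 1)
  have hy : ∀ n, 0 < y n := fun n => by positivity
  have hy0 : Tendsto y atTop (𝓝 0) := tendsto_one_div_add_atTop_nhds_zero_nat
  have hlim : ∀ᵐ t : ℝ, ‖f t / E t‖ₑ ^ 2
      = liminf (fun n => ‖f (t + y n * Complex.I) / E (t + y n * Complex.I)‖ₑ ^ 2) atTop := by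
    filter_upwards [hE.ae_ne_zero] with t ht
    have hp : Tendsto (fun n => (t : ℂ) + y n * Complex.I) atTop (𝓝 t) := by
      have : Tendsto (fun n => (t : ℂ) + (y n : ℂ) * Complex.I) atTop
          (𝓝 ((t : ℂ) + ((0 : ℝ) : ℂ) * Complex.I)) :=
        ((Complex.continuous_ofReal.tendsto 0).comp hy0 |>.mul_const _).const_add _
      simpa using this
    have h1 := ((hfc.tendsto t).comp hp).div ((hEc.tendsto t).comp hp) ht
    have h2 := (ENNReal.continuous_pow 2).tendsto _ |>.comp h1.enorm
    exact h2.liminf_eq.symm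
  rw [lintegral_congr_ae hlim]
  refine lt_of_le_of_lt (lintegral_liminf_le fun n => ?_) ?_
  · exact (hmeas (y n * Complex.I)).enorm.pow_const 2
  · refine lt_of_le_of_lt ?_ (ENNReal.coe_lt_top (r := C))
    refine liminf_le_of_frequently_le' (Frequently.of_forall fun n => ?_)
    exact hC (y n) (hy n)

/-- The inner product `∫ conj (f t) g t / |E t|² dt` of `H(E)`, conjugate linear in the first
variable. -/
def innerProd (f g : Space E hE) : ℂ := ∫ t : ℝ, conj (f t) * g t / (‖E t‖ : ℂ) ^ 2

lemma integrable_inner (f g : Space E hE) :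
    Integrable fun t : ℝ => conj (f t) * g t / (‖E t‖ : ℂ) ^ 2 := by
  have h := MemLp.integrable_mul (p := 2) (q := 2) f.memLp.star g.memLp
  refine h.congr (Eventually.of_forall fun t => ?_)
  simp only [Pi.mul_apply, Pi.star_apply, RCLike.star_def, map_div₀]
  rw [← Complex.conj_mul', div_mul_div_comm]

lemma innerProd_self (f : Space E hE) :
    innerProd f f = ((∫ t : ℝ, ‖f t‖ ^ 2 / ‖E t‖ ^ 2 : ℝ) : ℂ) := by
  rw [innerProd, ← integral_complex_ofReal]
  congr 1; ext t
  rw [Complex.conj_mul']; push_cast; rfl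

lemma integrable_normSq (f : Space E hE) :
    Integrable fun t : ℝ => ‖f t‖ ^ 2 / ‖E t‖ ^ 2 := by
  refine (integrable_inner f f).norm.congr (Eventually.of_forall fun t => ?_)
  simp [sq]

/-- The inner product structure of `H(E)`. -/
@[reducible] def core (E : ℂ → ℂ) (hE : IsHermiteBiehler E) : InnerProductSpace.Core ℂ (Space E hE) where
  inner := innerProd
  conj_inner_symm f g := by
    change conj (innerProd g f) = innerProd f g
    rw [innerProd, innerProd, ← integral_conj]
    congr 1; ext t
    simp [mul_comm]
  re_inner_nonneg f := by
    change 0 ≤ (innerProd f f).re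
    rw [innerProd_self, Complex.ofReal_re]
    positivity
  add_left f g h := by
    change innerProd (f + g) h = innerProd f h + innerProd g h
    rw [innerProd, innerProd, innerProd,
      ← integral_add (integrable_inner f h) (integrable_inner g h)]
    congr 1; ext t
    simp; ring
  smul_left f g c := by
    change innerProd (c • f) g = conj c * innerProd f g
    rw [innerProd, innerProd, ← integral_const_mul]
    congr 1; ext t
    simp; ring
  definite f hf := by
    change innerProd f f = 0 at hf
    rw [innerProd_self, Complex.ofReal_eq_zero,
      integral_eq_zero_iff_of_nonneg (fun t => by positivity) (integrable_normSq f)] at hf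
    by_contra hne
    obtain ⟨w, hw⟩ : ∃ w, f w ≠ 0 := by
      by_contra! h
      exact hne (Space.ext h)
    have hF : ∀ᵐ _t : ℝ, False := by
      filter_upwards [hf, DeBranges.ae_ne_zero f.differentiable hw, hE.ae_ne_zero] with t h1 h2 h3
      simp [h2, h3] at h1
    rw [eventually_false_iff_eq_bot, ae_eq_bot] at hF
    exact NeZero.ne (volume : Measure ℝ) hF

instance : NormedAddCommGroup (Space E hE) := (core E hE).toNormedAddCommGroup

instance : InnerProductSpace ℂ (Space E hE) := InnerProductSpace.ofCore (core E hE).toCore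

lemma inner_def (f g : Space E hE) :
    inner ℂ f g = ∫ t : ℝ, conj (f t) * g t / (‖E t‖ : ℂ) ^ 2 := rfl

/-- `T` is the composition operator `C_φ f = f ∘ φ` on `H(E)`. As `T` is a continuous linear map
of `H(E)` to itself, its existence says that `C_φ` is bounded on `H(E)`. -/
def IsCompositionOperator (φ : ℂ → ℂ) (T : Space E hE →L[ℂ] Space E hE) : Prop :=
  ∀ (f : Space E hE) (z : ℂ), T f z = f (φ z)

/-- `A = (E + E^#) / 2`. -/
def partA (E : ℂ → ℂ) (z : ℂ) : ℂ := (E z + sharp E z) / 2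

/-- The ratio `‖k_{φ(t)}‖² / ‖k_t‖²` at a real zero `t` of `A`, expressed through `E`. -/
def kernelRatio (E φ : ℂ → ℂ) (t : ℝ) : ℂ :=
  if (φ t).im ≠ 0 then
    ((‖E (φ t)‖ : ℂ) ^ 2 - (‖E (conj (φ t))‖ : ℂ) ^ 2) /
      (-4 * Complex.I * ((φ t).im : ℂ) * E t * ((deriv E t).re : ℂ))
  else
    (-Complex.I * ((deriv E (φ t) * conj (E (φ t))).im : ℂ)) / (E t * ((deriv E t).re : ℂ))

/-- At the real zeros of `A` the ratio is a real number, so that its real part is the ratio. -/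
lemma kernelRatio_im (E φ : ℂ → ℂ) {t : ℝ} (ht : partA E t = 0) :
    (kernelRatio E φ t).im = 0 := by
  have hre : (E t).re = 0 := by
    have := congrArg Complex.re ht
    simp [partA, sharp] at this
    linarith
  obtain ⟨y, hy⟩ : ∃ y : ℝ, E t = -(y : ℂ) * Complex.I :=
    ⟨-(E t).im, by apply Complex.ext <;> simp [hre]⟩
  unfold kernelRatio
  rw [hy]
  split_ifs
  · have : ∀ a b : ℝ, -4 * Complex.I * (a : ℂ) * (-(y : ℂ) * Complex.I) * (b : ℂ)
        = ((-4 * a * y * b : ℝ) : ℂ) := by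
      intro a b; push_cast; linear_combination (4 * (a : ℂ) * y * b) * Complex.I_sq
    rw [this]
    norm_cast
  · have : ∀ a b : ℝ, -Complex.I * (a : ℂ) / (-(y : ℂ) * Complex.I * (b : ℂ))
        = ((a / (y * b) : ℝ) : ℂ) := by
      intro a b
      rw [show -(y : ℂ) * Complex.I * (b : ℂ) = -Complex.I * (y * b) by ring,
        mul_div_mul_left _ _ (by simp)]
      push_cast; rfl
    rw [this, Complex.ofReal_im]

end DeBranges

end

namespace DeBranges

/-! Write `k_w` for the reproducing kernel of `H(E)` at `w`. At a zero of `A` the value of `E` is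
purely imaginary, which makes the kernels at distinct `t_n` orthogonal; normalized, they form an
orthonormal sequence `e_n` (`orthonormal_kernel`). Since `⟨e_n, C_φ f⟩` (conjugate linear in `e_n`)
equals `f(φ(t_n)) / ‖k_{t_n}‖`, its supremum over the unit ball is `‖k_{φ(t_n)}‖ / ‖k_{t_n}‖`, and
`r_n` is the square of this number (`kernelRatio_re`). For a compact operator these suprema tend to
`0` (`eventually_norm_inner_le_of_isCompactOperator`), which contradicts a positive limsup. Testing
with `f = k_{φ(t_n)}` replaces the adjoint, so completeness of `H(E)` is not needed.

The analytic work is the reproducing property `inner_kernel`, derived from the definition of `H²` by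
bounds on horizontal lines. For nonreal `w` the inner product with `k_w` splits into Cauchy
integrals of `g / E` and `g^# / E`, evaluated by `MemHardyTwo.integral_div_sub` and
`MemHardyTwo.integral_div_sub_eq_zero`. Real `w` are reached as weak limits of nonreal ones. -/

/-! ### Weak convergence in `L²` and compact operators -/

lemma lintegral_mul_le_sqrt_mul_sqrt {α : Type*} [MeasurableSpace α] {μ : Measure α}
    {f g : α → ℝ≥0∞} (hf : AEMeasurable f μ) (hg : AEMeasurable g μ) :
    ∫⁻ a, f a * g a ∂μ ≤ (∫⁻ a, f a ^ 2 ∂μ) ^ (1 / 2 : ℝ) * (∫⁻ a, g a ^ 2 ∂μ) ^ (1 / 2 : ℝ) := by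
  have h := ENNReal.lintegral_mul_le_Lp_mul_Lq μ Real.HolderConjugate.two_two hf hg
  simpa only [Pi.mul_apply, ENNReal.rpow_ofNat] using h

lemma enorm_sub_sq_le (a b : ℂ) : ‖a - b‖ₑ ^ 2 ≤ 2 * ‖a‖ₑ ^ 2 + 2 * ‖b‖ₑ ^ 2 := by
  have h : ‖a - b‖₊ ^ 2 ≤ 2 * ‖a‖₊ ^ 2 + 2 * ‖b‖₊ ^ 2 := by
    rw [← NNReal.coe_le_coe]
    push_cast
    nlinarith [norm_sub_le a b, norm_nonneg (a - b), sq_nonneg (‖a‖ - ‖b‖)]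
  simp only [enorm_eq_nnnorm]
  exact_mod_cast h

lemma lintegral_enorm_sq_lt_top {α : Type*} [MeasurableSpace α] {μ : Measure α} {f : α → ℂ}
    (hf : MemLp f 2 μ) : ∫⁻ x, ‖f x‖ₑ ^ 2 ∂μ < ∞ := by
  have := (eLpNorm_lt_top_iff_lintegral_rpow_enorm_lt_top (p := 2) (by norm_num) (by norm_num)).1
    hf.2
  simpa only [ENNReal.toReal_ofNat, ENNReal.rpow_ofNat] using this

lemma memLp_two_of_lintegral {α : Type*} [MeasurableSpace α] {μ : Measure α} {f : α → ℂ}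
    (hf : AEStronglyMeasurable f μ) (h : ∫⁻ x, ‖f x‖ₑ ^ 2 ∂μ < ∞) : MemLp f 2 μ := by
  refine ⟨hf, ?_⟩
  rw [eLpNorm_lt_top_iff_lintegral_rpow_enorm_lt_top (by norm_num) (by norm_num)]
  simpa only [ENNReal.toReal_ofNat, ENNReal.rpow_ofNat] using h

/-- A bounded sequence in `L²` that converges almost everywhere converges weakly. -/
lemma tendsto_integral_mul_of_bounded {α : Type*} [MeasurableSpace α] {μ : Measure α}
    {G : ℕ → α → ℂ} {G' h : α → ℂ} {C : ℝ≥0}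
    (hG : ∀ n, AEStronglyMeasurable (G n) μ) (hC : ∀ n, ∫⁻ x, ‖G n x‖ₑ ^ 2 ∂μ ≤ C)
    (hG' : MemLp G' 2 μ) (hh : MemLp h 2 μ)
    (hlim : ∀ᵐ x ∂μ, Tendsto (fun n => G n x) atTop (𝓝 (G' x))) :
    Tendsto (fun n => ∫ x, G n x * h x ∂μ) atTop (𝓝 (∫ x, G' x * h x ∂μ)) := by
  have hGL : ∀ n, MemLp (G n) 2 μ := fun n =>
    memLp_two_of_lintegral (hG n) ((hC n).trans_lt ENNReal.coe_lt_top)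
  have hD : ∀ n, AEMeasurable (fun x => ‖G n x - G' x‖ₑ) μ := fun n =>
    ((hG n).sub hG'.1).enorm
  have hk : AEMeasurable (fun x => ‖h x‖ₑ) μ := hh.1.enorm
  obtain ⟨B, hB⟩ := ENNReal.lt_iff_exists_coe.1 (lintegral_enorm_sq_lt_top hG') |>.imp
    fun _ h => h.1
  have hDsq : ∀ n, ∫⁻ x, ‖G n x - G' x‖ₑ ^ 2 ∂μ ≤ (2 * C + 2 * B : ℝ≥0) := fun n => by
    calc ∫⁻ x, ‖G n x - G' x‖ₑ ^ 2 ∂μ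
        ≤ ∫⁻ x, (2 * ‖G n x‖ₑ ^ 2 + 2 * ‖G' x‖ₑ ^ 2) ∂μ :=
          lintegral_mono fun x => enorm_sub_sq_le _ _
      _ = 2 * (∫⁻ x, ‖G n x‖ₑ ^ 2 ∂μ) + 2 * ∫⁻ x, ‖G' x‖ₑ ^ 2 ∂μ := by
          rw [lintegral_add_left' (((hG n).enorm.pow_const 2).const_mul 2),
            lintegral_const_mul' _ _ (by simp), lintegral_const_mul' _ _ (by simp)]
      _ ≤ 2 * C + 2 * B := by rw [hB]; gcongr; exact hC n
      _ = _ := by push_cast; rfl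
  refine tendsto_integral_of_L1' _ (hG'.integrable_mul hh).aestronglyMeasurable
    (Eventually.of_forall fun n => (hGL n).integrable_mul hh) ?_
  have heq : ∀ n, eLpNorm ((fun x => G n x * h x) - fun x => G' x * h x) 1 μ
      = ∫⁻ x, ‖G n x - G' x‖ₑ * ‖h x‖ₑ ∂μ := fun n => by
    rw [eLpNorm_one_eq_lintegral_enorm]
    refine lintegral_congr fun x => ?_
    rw [← enorm_mul, sub_mul]; rfl
  refine Tendsto.congr (fun n => (heq n).symm) ?_
  rw [ENNReal.tendsto_nhds_zero]
  intro ε hε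
  -- `M` is the truncation level: the part where the difference exceeds `M * ‖h‖` will cost at most
  -- the `L²` bound divided by `M`.
  obtain ⟨M, hM0, hM⟩ : ∃ M : ℝ≥0, M ≠ 0 ∧ ((2 * C + 2 * B : ℝ≥0) : ℝ≥0∞) / M ≤ ε / 2 := by
    have h1 : Tendsto (fun n : ℕ => ((2 * C + 2 * B : ℝ≥0) : ℝ≥0∞) / n) atTop (𝓝 0) := by
      simpa only [ENNReal.div_top] using ENNReal.Tendsto.const_div ENNReal.tendsto_nat_nhds_top
        (Or.inr (ENNReal.coe_ne_top (r := 2 * C + 2 * B)))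
    have h2 := (ENNReal.tendsto_nhds_zero.1 h1 (ε / 2) (ENNReal.half_pos hε.ne')).and
      (eventually_gt_atTop 0)
    obtain ⟨n, hn1, hn2⟩ := h2.exists
    exact ⟨n, by exact_mod_cast hn2.ne', by simpa using hn1⟩
  -- Where `a ≤ M * b` the product is dominated by the integrable `M * b ^ 2`, so dominated
  -- convergence applies; elsewhere `b ≤ a / M`.
  have hpt : ∀ a b : ℝ≥0∞, a * b ≤ min (a * b) (M * b ^ 2) + a ^ 2 / M := by
    intro a b
    rcases le_total a (M * b) with hab | hab
    · have : a * b ≤ M * b ^ 2 := by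
        calc a * b ≤ M * b * b := by gcongr
          _ = M * b ^ 2 := by ring
      rw [min_eq_left this]
      exact le_self_add
    · have : b ≤ a / M := by
        rw [ENNReal.le_div_iff_mul_le (Or.inl (by exact_mod_cast hM0))
          (Or.inl ENNReal.coe_ne_top), mul_comm]
        exact hab
      calc a * b ≤ a * (a / M) := by gcongr
        _ = a ^ 2 / M := by rw [sq, mul_div_assoc]
        _ ≤ _ := le_add_self
  have hdom : Tendsto (fun n => ∫⁻ x, min (‖G n x - G' x‖ₑ * ‖h x‖ₑ) (M * ‖h x‖ₑ ^ 2) ∂μ)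
      atTop (𝓝 0) := by
    have := tendsto_lintegral_of_dominated_convergence' (μ := μ)
      (F := fun n x => min (‖G n x - G' x‖ₑ * ‖h x‖ₑ) (M * ‖h x‖ₑ ^ 2)) (f := fun _ => 0)
      (fun x => M * ‖h x‖ₑ ^ 2)
      (fun n => ((hD n).mul hk).min ((hk.pow_const 2).const_mul _))
      (fun n => Eventually.of_forall fun x => min_le_right _ _)
      (by
        rw [lintegral_const_mul' _ _ ENNReal.coe_ne_top]
        exact ENNReal.mul_ne_top ENNReal.coe_ne_top (lintegral_enorm_sq_lt_top hh).ne)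
      (by
        filter_upwards [hlim] with x hx
        have h1 : Tendsto (fun n => ‖G n x - G' x‖ₑ * ‖h x‖ₑ) atTop (𝓝 0) := by
          have h0 : Tendsto (fun n => ‖G n x - G' x‖ₑ) atTop (𝓝 0) := by
            simpa using (hx.sub_const (G' x)).enorm
          simpa using ENNReal.Tendsto.mul_const h0 (Or.inr enorm_ne_top)
        exact tendsto_of_tendsto_of_tendsto_of_le_of_le tendsto_const_nhds h1
          (fun _ => zero_le) (fun _ => min_le_left _ _))
    simpa using this
  filter_upwards [ENNReal.tendsto_nhds_zero.1 hdom (ε / 2) (ENNReal.half_pos hε.ne')] with n hn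
  calc ∫⁻ x, ‖G n x - G' x‖ₑ * ‖h x‖ₑ ∂μ
      ≤ ∫⁻ x, (min (‖G n x - G' x‖ₑ * ‖h x‖ₑ) (M * ‖h x‖ₑ ^ 2) + ‖G n x - G' x‖ₑ ^ 2 / M) ∂μ :=
        lintegral_mono fun x => hpt _ _
    _ = (∫⁻ x, min (‖G n x - G' x‖ₑ * ‖h x‖ₑ) (M * ‖h x‖ₑ ^ 2) ∂μ)
        + (∫⁻ x, ‖G n x - G' x‖ₑ ^ 2 ∂μ) / M := by
        simp only [div_eq_mul_inv]
        have hmin : AEMeasurable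
            (fun x => min (‖G n x - G' x‖ₑ * ‖h x‖ₑ) (M * ‖h x‖ₑ ^ 2)) μ :=
          ((hD n).mul hk).min ((hk.pow_const 2).const_mul _)
        rw [lintegral_add_left' hmin, lintegral_mul_const' _ _ (by simpa using hM0)]
    _ ≤ ε / 2 + (2 * C + 2 * B : ℝ≥0) / M := by gcongr; exact hDsq n
    _ ≤ ε / 2 + ε / 2 := by gcongr
    _ = ε := ENNReal.add_halves ε

/-- A compact operator is uniformly small, on the unit ball, in the direction of the late members
of an orthonormal sequence. -/
lemma eventually_norm_inner_le_of_isCompactOperator {H : Type*} [NormedAddCommGroup H]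
    [InnerProductSpace ℂ H] {T : H →L[ℂ] H} (hT : IsCompactOperator T) {e : ℕ → H}
    (he : Orthonormal ℂ e) {ε : ℝ} (hε : 0 < ε) :
    ∀ᶠ n in atTop, ∀ f : H, ‖inner ℂ (e n) (T f)‖ ≤ ε * ‖f‖ := by
  obtain ⟨K, hK, hTK⟩ := hT
  obtain ⟨δ, hδ, hball⟩ := Metric.mem_nhds_iff.1 hTK
  -- A finite net reduces uniformity in `f` to finitely many vectors, for which Bessel's inequality
  -- gives decay. Net error and decay contribute `ε * δ / 4` each; undoing the scaling by `δ / 2 /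
  -- ‖f‖` turns their sum into `ε * ‖f‖`.
  obtain ⟨s, hs, hcover⟩ := Metric.totallyBounded_iff.1 hK.totallyBounded (ε * δ / 4) (by positivity)
  have hev : ∀ᶠ n in atTop, ∀ y ∈ s, ‖inner ℂ (e n) y‖ < ε * δ / 4 := by
    rw [eventually_all_finite hs]
    intro y _
    have h1 := (he.inner_products_summable (x := y)).tendsto_atTop_zero
    have h2 : Tendsto (fun n => ‖inner ℂ (e n) y‖) atTop (𝓝 0) := by
      simpa [Function.comp_def, Real.sqrt_sq] using (Real.continuous_sqrt.tendsto 0).comp h1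
    exact h2.eventually_lt_const (by positivity)
  filter_upwards [hev] with n hn f
  rcases eq_or_ne f 0 with rfl | hf
  · simp
  have hf' : 0 < ‖f‖ := norm_pos_iff.2 hf
  have hmem : T (((δ / 2 / ‖f‖ : ℝ) : ℂ) • f) ∈ K := by
    refine hball ?_
    rw [mem_ball_zero_iff, norm_smul, Complex.norm_real, Real.norm_of_nonneg (by positivity),
      div_mul_cancel₀ _ hf'.ne']
    linarith
  obtain ⟨y, hy, hyd⟩ := Set.mem_iUnion₂.1 (hcover hmem)
  rw [Metric.mem_ball, dist_eq_norm] at hyd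
  have h3 : ‖inner ℂ (e n) (T (((δ / 2 / ‖f‖ : ℝ) : ℂ) • f))‖ ≤ ε * δ / 2 := by
    have h4 := norm_inner_le_norm (𝕜 := ℂ) (e n) (T (((δ / 2 / ‖f‖ : ℝ) : ℂ) • f) - y)
    rw [he.1 n, one_mul, inner_sub_right] at h4
    have h5 := norm_sub_norm_le (inner ℂ (e n) (T (((δ / 2 / ‖f‖ : ℝ) : ℂ) • f)))
      (inner ℂ (e n) y)
    have := hn y hy
    linarith
  rw [map_smul, inner_smul_right, norm_mul, Complex.norm_real,
    Real.norm_of_nonneg (by positivity)] at h3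
  rw [div_mul_eq_mul_div, div_le_iff₀ hf'] at h3
  nlinarith

/-! ### Integrals over horizontal lines -/

/-- The integral of a holomorphic function over horizontal lines does not depend on the line, if
the integrals of its modulus are bounded. -/
lemma integral_line_eq {H : ℂ → ℂ} (hH : DifferentiableOn ℂ H {z | 0 ≤ z.im}) {C : ℝ≥0}
    (hC : ∀ y : ℝ, 0 ≤ y → ∫⁻ x : ℝ, ‖H (x + y * Complex.I)‖ₑ ≤ C) {b : ℝ} (hb : 0 ≤ b) :
    ∫ x : ℝ, H x = ∫ x : ℝ, H (x + b * Complex.I) := by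
  have hcont : ∀ y : ℝ, 0 ≤ y → Continuous fun x : ℝ => H (x + y * Complex.I) := fun y hy =>
    hH.continuousOn.comp_continuous (by fun_prop) (fun x => by simpa using hy)
  have hint : ∀ y : ℝ, 0 ≤ y → Integrable fun x : ℝ => H (x + y * Complex.I) := fun y hy =>
    ⟨(hcont y hy).aestronglyMeasurable, (hC y hy).trans_lt ENNReal.coe_lt_top⟩
  have hstrip : Integrable (fun p : ℝ × ℝ => H (p.1 + p.2 * Complex.I))
      (volume.prod (volume.restrict (Set.Ioc 0 b))) := by
    have hm : AEStronglyMeasurable (fun p : ℝ × ℝ => H (p.1 + p.2 * Complex.I))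
        (volume.prod (volume.restrict (Set.Ioc 0 b))) := by
      have h1 : ContinuousOn (fun p : ℝ × ℝ => H (p.1 + p.2 * Complex.I))
          (Set.univ ×ˢ Set.Ioc 0 b) :=
        hH.continuousOn.comp (by fun_prop) (fun p hp => by simpa using hp.2.1.le)
      have h2 := h1.aestronglyMeasurable (μ := volume.prod volume)
        (MeasurableSet.univ.prod measurableSet_Ioc)
      rwa [← Measure.prod_restrict, Measure.restrict_univ] at h2
    refine ⟨hm, ?_⟩
    rw [HasFiniteIntegral, lintegral_prod_symm _ hm.enorm]
    calc ∫⁻ y in Set.Ioc 0 b, ∫⁻ x : ℝ, ‖H (x + y * Complex.I)‖ₑ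
        ≤ ∫⁻ _ in Set.Ioc 0 b, (C : ℝ≥0∞) :=
          setLIntegral_mono measurable_const fun y hy => hC y hy.1.le
      _ < ∞ := by
          rw [setLIntegral_const]
          exact ENNReal.mul_lt_top ENNReal.coe_lt_top measure_Ioc_lt_top
  -- By Fubini the integral over the vertical side at abscissa `R` is an integrable function of `R`.
  have hV := hstrip.integral_prod_left
  set V : ℝ → ℂ := fun R => ∫ y in Set.Ioc 0 b, H (R + y * Complex.I) with hVdef
  have hD : Integrable fun R => Complex.I * (V (-R) - V R) := (hV.comp_neg.sub hV).const_mul _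
  have hrect : ∀ R : ℝ, 0 ≤ R → (∫ x in (-R)..R, H x) - ∫ x in (-R)..R, H (x + b * Complex.I)
      = Complex.I * (V (-R) - V R) := by
    intro R hR
    have h := Complex.integral_boundary_rect_eq_zero_of_differentiableOn H (-R : ℝ)
      (R + b * Complex.I) (hH.mono fun z hz => by
        have := hz.2
        simp only [Complex.ofReal_im, Complex.add_im, Complex.mul_im, Complex.ofReal_re,
          Complex.I_im, Complex.I_re, mul_one, mul_zero, add_zero, zero_add, Set.mem_preimage,
          Set.uIcc_of_le hb] at this
        exact this.1)
    simp only [Complex.ofReal_im, Complex.ofReal_re, Complex.add_im, Complex.add_re,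
      Complex.mul_im, Complex.mul_re, Complex.I_im, Complex.I_re, mul_one, mul_zero, add_zero,
      zero_add, sub_zero, Complex.ofReal_zero, zero_mul, smul_eq_mul,
      intervalIntegral.integral_of_le hb] at h
    simp only [hVdef]
    linear_combination h
  have hlim := (intervalIntegral_tendsto_integral (by simpa using hint 0 le_rfl)
    tendsto_neg_atTop_atBot tendsto_id).sub
    (intervalIntegral_tendsto_integral (hint b hb) tendsto_neg_atTop_atBot tendsto_id)
  have hlim' := hlim.congr' (f₂ := fun R => Complex.I * (V (-R) - V R)) (by
    filter_upwards [eventually_ge_atTop 0] with R hR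
    exact hrect R hR)
  -- The vertical contribution is integrable in `R` and has a limit as `R → ∞`, so the limit is `0`;
  -- no pointwise decay of `H` is required.
  have h0 := IntegrableAtFilter.eq_zero_of_tendsto
    (l := atTop) ⟨Set.univ, univ_mem, hD.integrableOn⟩ (fun s hs => by
      obtain ⟨c, hc⟩ := mem_atTop_sets.1 hs
      rw [← top_le_iff, ← Real.volume_Ici (a := c)]
      exact measure_mono hc) hlim'
  exact sub_eq_zero.1 h0

lemma integral_line_eq_zero {H : ℂ → ℂ} (hH : DifferentiableOn ℂ H {z | 0 ≤ z.im}) {C : ℝ≥0}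
    (hC : ∀ y : ℝ, 0 ≤ y → ∫⁻ x : ℝ, ‖H (x + y * Complex.I)‖ₑ ≤ C)
    (h0 : Tendsto (fun y : ℝ => ∫⁻ x : ℝ, ‖H (x + y * Complex.I)‖ₑ) atTop (𝓝 0)) :
    ∫ x : ℝ, H x = 0 := by
  have h1 : ‖∫ x : ℝ, H x‖ₑ ≤ 0 := by
    refine ge_of_tendsto h0 ?_
    filter_upwards [eventually_ge_atTop 0] with y hy
    rw [integral_line_eq hH hC hy]
    exact enorm_integral_le_lintegral_enorm _
  simpa using h1

/-- Up to the factor `π / s` this is the density of a Cauchy distribution. -/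
lemma integrable_inv_sq_add_sq (u : ℝ) {s : ℝ} (hs : 0 < s) :
    Integrable fun x : ℝ => ((x - u) ^ 2 + s ^ 2)⁻¹ := by
  lift s to ℝ≥0 using hs.le
  have h := (ProbabilityTheory.integrable_cauchyPDFReal u (γ := s)).const_mul
    (Real.pi * (s : ℝ)⁻¹)
  refine h.congr (Eventually.of_forall fun x => ?_)
  simp only [ProbabilityTheory.cauchyPDFReal_def]
  have := Real.pi_ne_zero
  field_simp

lemma integral_inv_sq_add_sq (u : ℝ) {s : ℝ} (hs : 0 < s) :
    ∫ x : ℝ, ((x - u) ^ 2 + s ^ 2)⁻¹ = Real.pi / s := by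
  lift s to ℝ≥0 using hs.le
  have h := ProbabilityTheory.integral_cauchyPDFReal_eq_one u (γ := s) (by
    intro h; simp [h] at hs)
  simp only [ProbabilityTheory.cauchyPDFReal_def] at h
  rw [integral_const_mul] at h
  have := Real.pi_ne_zero
  field_simp at h ⊢
  linarith

lemma normSq_line_sub (x y : ℝ) (w : ℂ) :
    ‖(x : ℂ) + y * Complex.I - w‖ ^ 2 = (x - w.re) ^ 2 + (y - w.im) ^ 2 := by
  rw [← Complex.normSq_eq_norm_sq, Complex.normSq_apply]
  simp; ring

lemma lintegral_enorm_inv_sq {w : ℂ} {y : ℝ} (hy : w.im < y) :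
    ∫⁻ x : ℝ, ‖((x : ℂ) + y * Complex.I - w)⁻¹‖ₑ ^ 2 = ENNReal.ofReal (Real.pi / (y - w.im)) := by
  rw [← integral_inv_sq_add_sq w.re (sub_pos.2 hy),
    ofReal_integral_eq_lintegral_ofReal (integrable_inv_sq_add_sq _ (sub_pos.2 hy))
      (Eventually.of_forall fun x => by positivity)]
  refine lintegral_congr fun x => ?_
  rw [← normSq_line_sub, ← ofReal_norm, norm_inv, ← ENNReal.ofReal_pow (by positivity), inv_pow]

/-! ### Membership in `H²` and boundary values -/

lemma isOpen_upperHalfPlane : IsOpen {z : ℂ | 0 < z.im} :=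
  isOpen_lt continuous_const Complex.continuous_im

lemma MemHardyTwo.continuous_line {F : ℂ → ℂ} (hF : MemHardyTwo F) {y : ℝ} (hy : 0 < y) :
    Continuous fun x : ℝ => F (x + y * Complex.I) :=
  hF.1.continuousOn.comp_continuous (by fun_prop) (fun x => by simpa using hy)

/-- The first majorant depends on `z.re` only, so it has the same integral `B * π / δ` on every
horizontal line. -/
lemma memHardyTwo_of_le {G F : ℂ → ℂ} (hG : DifferentiableOn ℂ G {z | 0 < z.im})
    (hF : MemHardyTwo F) {B D u δ : ℝ} (hB : 0 ≤ B) (hD : 0 ≤ D) (hδ : 0 < δ)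
    (h : ∀ z : ℂ, 0 < z.im → ‖G z‖ ^ 2 ≤ B * ((z.re - u) ^ 2 + δ ^ 2)⁻¹ + D * ‖F z‖ ^ 2) :
    MemHardyTwo G := by
  obtain ⟨C, hC⟩ := hF.2
  refine ⟨hG, (B * (Real.pi / δ)).toNNReal + D.toNNReal * C, fun y hy => ?_⟩
  calc ∫⁻ x : ℝ, ‖G (x + y * Complex.I)‖ₑ ^ 2
      ≤ ∫⁻ x : ℝ, (ENNReal.ofReal (B * ((x - u) ^ 2 + δ ^ 2)⁻¹)
          + ENNReal.ofReal D * ‖F (x + y * Complex.I)‖ₑ ^ 2) := by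
        refine lintegral_mono fun x => ?_
        have h1 := h (x + y * Complex.I) (by simpa using hy)
        simp only [Complex.add_re, Complex.ofReal_re, Complex.mul_re, Complex.I_re, mul_zero,
          Complex.ofReal_im, Complex.I_im, mul_one, sub_self, add_zero] at h1
        rw [← ofReal_norm, ← ofReal_norm, ← ENNReal.ofReal_pow (by positivity),
          ← ENNReal.ofReal_pow (by positivity), ← ENNReal.ofReal_mul hD,
          ← ENNReal.ofReal_add (by positivity) (by positivity)]
        exact ENNReal.ofReal_le_ofReal h1
    _ = ENNReal.ofReal (B * (Real.pi / δ))
          + ENNReal.ofReal D * ∫⁻ x : ℝ, ‖F (x + y * Complex.I)‖ₑ ^ 2 := by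
        rw [lintegral_add_left (by fun_prop), lintegral_const_mul' _ _ (by simp),
          ← ofReal_integral_eq_lintegral_ofReal ((integrable_inv_sq_add_sq u hδ).const_mul B)
            (Eventually.of_forall fun x => by positivity), integral_const_mul,
          integral_inv_sq_add_sq u hδ]
    _ ≤ ENNReal.ofReal (B * (Real.pi / δ)) + ENNReal.ofReal D * C := by gcongr; exact hC y hy
    _ = _ := by push_cast; rfl

/-- A holomorphic function on the upper half-plane that is bounded near `v` and `O(1 / |z - v|)`
belongs to `H²`. -/
lemma memHardyTwo_of_bounds {G : ℂ → ℂ} (hG : DifferentiableOn ℂ G {z | 0 < z.im}) {v : ℂ}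
    {δ M C : ℝ} (hδ : 0 < δ) (hM : ∀ z : ℂ, 0 < z.im → ‖z - v‖ < δ → ‖G z‖ ≤ M)
    (hC : ∀ z : ℂ, 0 < z.im → ‖G z‖ * ‖z - v‖ ≤ C) : MemHardyTwo G := by
  -- The factor `2` comes from bounding `(z.re - v.re) ^ 2 + δ ^ 2` by twice the larger of `‖z - v‖
  -- ^ 2` and `δ ^ 2`; the two summands of `B` serve the two cases.
  refine memHardyTwo_of_le (B := 2 * (C ^ 2 + M ^ 2 * δ ^ 2)) (D := 0) (u := v.re) hG
    memHardyTwo_zero (by positivity) le_rfl hδ fun z hz => ?_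
  rw [zero_mul, add_zero, ← div_eq_mul_inv, le_div_iff₀ (by positivity)]
  have h1 : (z.re - v.re) ^ 2 ≤ ‖z - v‖ ^ 2 := by
    rw [← Complex.normSq_eq_norm_sq, Complex.normSq_apply, Complex.sub_re]
    nlinarith [mul_self_nonneg (z - v).im]
  have h0 := norm_nonneg (G z)
  have h2 := norm_nonneg (z - v)
  rcases lt_or_ge ‖z - v‖ δ with hlt | hge
  · have h3 : ‖G z‖ ^ 2 ≤ M ^ 2 := by gcongr; exact hM z hz hlt
    have h4 : (z.re - v.re) ^ 2 + δ ^ 2 ≤ 2 * δ ^ 2 := by nlinarith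
    calc _ ≤ M ^ 2 * (2 * δ ^ 2) := by gcongr
      _ ≤ _ := by nlinarith [sq_nonneg C]
  · have h3 : (‖G z‖ * ‖z - v‖) ^ 2 ≤ C ^ 2 := by gcongr; exact hC z hz
    have h4 : (z.re - v.re) ^ 2 + δ ^ 2 ≤ 2 * ‖z - v‖ ^ 2 := by nlinarith
    calc _ ≤ ‖G z‖ ^ 2 * (2 * ‖z - v‖ ^ 2) := by gcongr
      _ ≤ _ := by nlinarith [sq_nonneg (M * δ)]

lemma memHardyTwo_inv_sub {w : ℂ} (hw : w.im < 0) : MemHardyTwo fun z => (z - w)⁻¹ := by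
  have hne : ∀ z : ℂ, 0 < z.im → z - w ≠ 0 := fun z hz h => by
    have := congrArg Complex.im h
    simp at this; linarith
  -- No point of the upper half-plane lies within `-w.im` of `w`, so the bound `M` is vacuous.
  refine memHardyTwo_of_bounds (v := w) (δ := -w.im) (M := 0) (C := 1) ?_ (by linarith)
    (fun z hz hlt => ?_) (fun z hz => ?_)
  · exact fun z hz => ((differentiableAt_id.sub_const w).inv (hne z hz)).differentiableWithinAt
  · have := Complex.abs_im_le_norm (z - w)
    rw [Complex.sub_im, abs_of_pos (by linarith)] at this
    linarith
  · rw [norm_inv, inv_mul_cancel₀ (norm_ne_zero_iff.2 (hne z hz))]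

/-- Dividing out a zero in the upper half-plane does not leave `H²`. -/
lemma memHardyTwo_dslope {F : ℂ → ℂ} (hF : MemHardyTwo F) {w : ℂ} (hw : 0 < w.im)
    (h0 : F w = 0) : MemHardyTwo (dslope F w) := by
  have hd : DifferentiableOn ℂ (dslope F w) {z | 0 < z.im} :=
    (Complex.differentiableOn_dslope (isOpen_upperHalfPlane.mem_nhds hw)).2 hF.1
  have hc : ContinuousAt (dslope F w) w :=
    (hd.differentiableAt (isOpen_upperHalfPlane.mem_nhds hw)).continuousAt
  obtain ⟨δ, hδ, hball⟩ := Metric.eventually_nhds_iff.1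
    (hc.norm.eventually_lt_const (lt_add_one ‖dslope F w w‖))
  set M := ‖dslope F w w‖ + 1
  -- Near `w` continuity bounds the quotient by `M`; at distance at least `δ` it is at most `‖F z‖ /
  -- δ`.
  refine memHardyTwo_of_le (B := 2 * (M ^ 2 * δ ^ 2)) (D := (δ⁻¹) ^ 2) (u := w.re) hd hF
    (by positivity) (by positivity) hδ fun z hz => ?_
  rcases lt_or_ge ‖z - w‖ δ with hlt | hge
  · have h1 : (z.re - w.re) ^ 2 ≤ ‖z - w‖ ^ 2 := by
      rw [← Complex.normSq_eq_norm_sq, Complex.normSq_apply, Complex.sub_re]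
      nlinarith [mul_self_nonneg (z - w).im]
    have h2 := norm_nonneg (z - w)
    have h3 : ‖dslope F w z‖ ^ 2 ≤ M ^ 2 := by
      gcongr
      exact (hball (by rwa [dist_eq_norm])).le
    have h4 : (z.re - w.re) ^ 2 + δ ^ 2 ≤ 2 * δ ^ 2 := by nlinarith
    refine le_add_of_le_of_nonneg ?_ (by positivity)
    rw [← div_eq_mul_inv, le_div_iff₀ (by positivity)]
    calc _ ≤ M ^ 2 * (2 * δ ^ 2) := by gcongr
      _ = _ := by ring
  · refine le_add_of_nonneg_of_le (by positivity) ?_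
    have hzw : z ≠ w := by
      rintro rfl
      rw [sub_self, norm_zero] at hge
      linarith
    rw [dslope_of_ne _ hzw, slope_def_field, h0, sub_zero, norm_div, div_eq_inv_mul, mul_pow]
    gcongr

lemma tendsto_line_boundary {F : ℂ → ℂ} {x : ℝ} (hc : ContinuousAt F x) :
    Tendsto (fun n : ℕ => F (x + (1 / ((n : ℝ) + 1) : ℝ) * Complex.I)) atTop (𝓝 (F x)) := by
  refine hc.tendsto.comp ?_
  have h := (Complex.continuous_ofReal.tendsto 0).comp
    (tendsto_one_div_add_atTop_nhds_zero_nat (𝕜 := ℝ))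
  have := (h.mul_const Complex.I).const_add (x : ℂ)
  simpa [Function.comp_def] using this

/-- Fatou's lemma along the heights `1 / (n + 1)`. Continuity is asked only almost everywhere
because `E`, by which one divides later, may have real zeros. -/
lemma MemHardyTwo.memLp_boundary {F : ℂ → ℂ} (hF : MemHardyTwo F)
    (hc : ∀ᵐ x : ℝ, ContinuousAt F x) : MemLp (fun x : ℝ => F x) 2 := by
  have hcont : ∀ n : ℕ, Continuous fun x : ℝ =>
      F (x + (1 / ((n : ℝ) + 1) : ℝ) * Complex.I) := fun n =>
    hF.continuous_line (by positivity)
  have hlim : ∀ᵐ x : ℝ, Tendsto (fun n : ℕ =>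
      F (x + (1 / ((n : ℝ) + 1) : ℝ) * Complex.I)) atTop (𝓝 (F x)) := by
    filter_upwards [hc] with x hx using tendsto_line_boundary hx
  refine memLp_two_of_lintegral (aestronglyMeasurable_of_tendsto_ae atTop
    (fun n => (hcont n).aestronglyMeasurable) hlim) ?_
  obtain ⟨C, hC⟩ := hF.2
  have hlim2 : ∀ᵐ x : ℝ, ‖F x‖ₑ ^ 2 = liminf (fun n : ℕ =>
      ‖F (x + (1 / ((n : ℝ) + 1) : ℝ) * Complex.I)‖ₑ ^ 2) atTop := by
    filter_upwards [hlim] with x hx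
    exact ((ENNReal.continuous_pow 2).tendsto _ |>.comp hx.enorm).liminf_eq.symm
  rw [lintegral_congr_ae hlim2]
  refine (lintegral_liminf_le fun n => ?_).trans_lt
    (lt_of_le_of_lt ?_ (ENNReal.coe_lt_top (r := C)))
  · exact (hcont n).measurable.enorm.pow_const 2
  · exact liminf_le_of_frequently_le' (Frequently.of_forall fun n => hC _ (by positivity))

/-! ### The Cauchy formula in `H²` -/

lemma memLp_inv_sub {w : ℂ} (hw : w.im < 0) : MemLp (fun x : ℝ => ((x : ℂ) - w)⁻¹) 2 := by
  refine memLp_two_of_lintegral (by fun_prop) ?_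
  have := lintegral_enorm_inv_sq (w := w) (y := 0) hw
  simp only [Complex.ofReal_zero, zero_mul, add_zero] at this
  rw [this]
  exact ENNReal.ofReal_lt_top

/-- Raising the line to height `b` does not change the integral, and by Cauchy–Schwarz it is at most
a constant times `(π / (b - w.im)) ^ (1 / 2)`, which tends to `0`. Starting at height `y > 0` keeps
the integrand holomorphic up to the line. -/
lemma MemHardyTwo.integral_line_div_sub_eq_zero {G : ℂ → ℂ} (hG : MemHardyTwo G) {w : ℂ}
    (hw : w.im < 0) {y : ℝ} (hy : 0 < y) :
    ∫ x : ℝ, G (x + y * Complex.I) * ((x : ℂ) - w)⁻¹ = 0 := by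
  obtain ⟨C, hC⟩ := hG.2
  set H : ℂ → ℂ := fun z => G (z + y * Complex.I) * (z - w)⁻¹
  have hne : ∀ z : ℂ, 0 ≤ z.im → z - w ≠ 0 := fun z hz h => by
    have := congrArg Complex.im h
    simp at this; linarith
  have hH : DifferentiableOn ℂ H {z | 0 ≤ z.im} := by
    intro z hz
    have h1 : DifferentiableAt ℂ G (z + y * Complex.I) :=
      hG.1.differentiableAt (isOpen_upperHalfPlane.mem_nhds (by
        have : 0 ≤ z.im := hz
        simp; linarith))
    exact ((h1.comp z (differentiableAt_id.add_const _)).mul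
      ((differentiableAt_id.sub_const w).inv (hne z hz))).differentiableWithinAt
  have hbd : ∀ b : ℝ, 0 ≤ b → ∫⁻ x : ℝ, ‖H (x + b * Complex.I)‖ₑ
      ≤ (C : ℝ≥0∞) ^ (1 / 2 : ℝ) * ENNReal.ofReal (Real.pi / (b - w.im)) ^ (1 / 2 : ℝ) := by
    intro b hb
    have hl : ∀ x : ℝ, (x : ℂ) + b * Complex.I + y * Complex.I
        = x + ((b + y : ℝ) : ℂ) * Complex.I := fun x => by push_cast; ring
    simp only [H, hl, enorm_mul]
    refine (lintegral_mul_le_sqrt_mul_sqrt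
      (hG.continuous_line (by linarith)).measurable.enorm.aemeasurable
      (by fun_prop)).trans ?_
    rw [lintegral_enorm_inv_sq (by linarith)]
    gcongr
    exact hC _ (by linarith)
  refine integral_line_eq_zero hH
    (C := ((C : ℝ≥0∞) ^ (1 / 2 : ℝ) * ENNReal.ofReal (Real.pi / (0 - w.im)) ^ (1 / 2 : ℝ)).toNNReal)
    (fun b hb => ?_) ?_
  · rw [ENNReal.coe_toNNReal]
    · refine (hbd b hb).trans ?_
      have := Real.pi_pos
      gcongr
    · exact ENNReal.mul_ne_top (by simp) (by simp)
  · have h1 : Tendsto (fun b : ℝ => Real.pi / (b - w.im)) atTop (𝓝 0) :=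
      tendsto_const_nhds.div_atTop (tendsto_atTop_add_const_right _ _ tendsto_id)
    have h2 : Tendsto (fun b : ℝ => (C : ℝ≥0∞) ^ (1 / 2 : ℝ)
        * ENNReal.ofReal (Real.pi / (b - w.im)) ^ (1 / 2 : ℝ)) atTop (𝓝 0) := by
      have h3 := (ENNReal.tendsto_ofReal h1).ennrpow_const (1 / 2 : ℝ)
      have h4 := ENNReal.Tendsto.const_mul h3 (a := (C : ℝ≥0∞) ^ (1 / 2 : ℝ)) (Or.inr (by simp))
      simpa using h4
    exact tendsto_of_tendsto_of_tendsto_of_le_of_le' tendsto_const_nhds h2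
      (Eventually.of_forall fun _ => zero_le)
      (by filter_upwards [eventually_ge_atTop 0] with b hb using hbd b hb)

/-- The Cauchy integral of the boundary function of `F ∈ H²` vanishes in the lower half-plane. -/
lemma MemHardyTwo.integral_div_sub_eq_zero {F : ℂ → ℂ} (hF : MemHardyTwo F)
    (hc : ∀ᵐ x : ℝ, ContinuousAt F x) {w : ℂ} (hw : w.im < 0) :
    ∫ x : ℝ, F x * ((x : ℂ) - w)⁻¹ = 0 := by
  obtain ⟨C, hC⟩ := hF.2
  have h := tendsto_integral_mul_of_bounded (μ := volume) (C := C)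
    (G := fun (n : ℕ) (x : ℝ) => F (x + (1 / ((n : ℝ) + 1) : ℝ) * Complex.I))
    (fun n => (hF.continuous_line (by positivity)).aestronglyMeasurable)
    (fun n => hC _ (by positivity)) (hF.memLp_boundary hc) (memLp_inv_sub hw)
    (by filter_upwards [hc] with x hx using tendsto_line_boundary hx)
  refine tendsto_nhds_unique h (tendsto_const_nhds.congr fun n => ?_)
  exact (hF.integral_line_div_sub_eq_zero hw (by positivity)).symm

/-- The Cauchy formula for `H²` of the upper half-plane. -/
lemma MemHardyTwo.integral_div_sub {F : ℂ → ℂ} (hF : MemHardyTwo F)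
    (hc : ∀ᵐ x : ℝ, ContinuousAt F x) {w : ℂ} (hw : 0 < w.im) :
    ∫ x : ℝ, F x * ((x : ℂ) - w)⁻¹ = 2 * Real.pi * Complex.I * F w := by
  have hw' : (conj w).im < 0 := by simpa using hw
  have hsub : w - conj w = 2 * w.im * Complex.I := by
    rw [Complex.sub_conj]; push_cast; ring
  have hsub0 : w - conj w ≠ 0 := by
    rw [hsub]
    simp [hw.ne']
  have hne : ∀ x : ℝ, (x : ℂ) - w ≠ 0 := fun x h => by
    have := congrArg Complex.im h
    simp at this; linarith
  have hne' : ∀ x : ℝ, (x : ℂ) - conj w ≠ 0 := fun x h => by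
    have := congrArg Complex.im h
    simp at this; linarith
  -- Chosen so that `F₀` vanishes at `w`.
  set c : ℂ := -(F w * (w - conj w)) with hcdef
  set F₀ : ℂ → ℂ := F + c • fun z => (z - conj w)⁻¹ with hF₀
  have hF₀0 : F₀ w = 0 := by
    simp only [hF₀, hcdef, Pi.add_apply, Pi.smul_apply, smul_eq_mul]
    field_simp
    ring
  have hF₀H : MemHardyTwo F₀ := hF.add ((memHardyTwo_inv_sub hw').const_smul c)
  have hF₀c : ∀ᵐ x : ℝ, ContinuousAt F₀ x := by
    filter_upwards [hc] with x hx
    exact hx.add (((continuousAt_id.sub continuousAt_const).inv₀ (hne' x)).const_smul c)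
  -- Since `(x - conj w) / (x - w) = 1 + (w - conj w) / (x - w)`, one has `F₀ x / (x - w) = G x / (x
  -- - conj w)`. This moves the pole to the lower half-plane, where the integral vanishes; only the
  -- Poisson kernel from the correction term remains.
  set G : ℂ → ℂ := F₀ + (w - conj w) • dslope F₀ w with hGdef
  have hGH : MemHardyTwo G := hF₀H.add ((memHardyTwo_dslope hF₀H hw hF₀0).const_smul _)
  have hGc : ∀ᵐ x : ℝ, ContinuousAt G x := by
    filter_upwards [hF₀c] with x hx
    exact hx.add (((continuousAt_dslope_of_ne (sub_ne_zero.1 (hne x))).2 hx).const_smul _)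
  have hG0 := hGH.integral_div_sub_eq_zero hGc hw'
  have hGi : Integrable fun x : ℝ => G x * ((x : ℂ) - conj w)⁻¹ :=
    (hGH.memLp_boundary hGc).integrable_mul (memLp_inv_sub hw')
  have hinv : ∀ x : ℝ, ((x : ℂ) - conj w)⁻¹ * ((x : ℂ) - w)⁻¹
      = (((x - w.re) ^ 2 + w.im ^ 2)⁻¹ : ℝ) := fun x => by
    rw [← mul_inv, Complex.ofReal_inv]
    have h : (x : ℂ) - conj w = conj ((x : ℂ) - w) := by simp
    rw [h, ← Complex.normSq_eq_conj_mul_self, Complex.normSq_apply]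
    congr 2
    simp
    ring
  have heq : ∀ x : ℝ, F x * ((x : ℂ) - w)⁻¹ = G x * ((x : ℂ) - conj w)⁻¹
      + -c * (((x - w.re) ^ 2 + w.im ^ 2)⁻¹ : ℝ) := fun x => by
    have hF₀x : F₀ x = F x + c * ((x : ℂ) - conj w)⁻¹ := rfl
    rw [← hinv, hGdef, Pi.add_apply, Pi.smul_apply, smul_eq_mul,
      dslope_of_ne _ (sub_ne_zero.1 (hne x)), slope_def_field, hF₀0, hF₀x]
    have h1 := hne x
    have h2 := hne' x
    field_simp
    ring
  have hPi : Integrable fun x : ℝ => -c * ((((x - w.re) ^ 2 + w.im ^ 2)⁻¹ : ℝ) : ℂ) :=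
    (integrable_inv_sq_add_sq w.re hw).ofReal.const_mul _
  simp_rw [heq]
  rw [integral_add hGi hPi, hG0, zero_add,
    integral_const_mul, integral_complex_ofReal, integral_inv_sq_add_sq _ hw, hcdef, hsub]
  have : (w.im : ℂ) ≠ 0 := by exact_mod_cast hw.ne'
  push_cast
  field_simp

/-! ### The reproducing kernels as elements of `H(E)` -/

variable {E : ℂ → ℂ} {hE : IsHermiteBiehler E}

lemma differentiable_sharp {f : ℂ → ℂ} (hf : Differentiable ℂ f) : Differentiable ℂ (sharp f) :=
  fun z => by
    have h := (hf (conj z)).conj_conj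
    rw [Complex.conj_conj] at h
    exact h

lemma deriv_sharp (f : ℂ → ℂ) (z : ℂ) : deriv (sharp f) z = conj (deriv f (conj z)) :=
  congrFun (deriv_conj_conj (f := f)) z

lemma sharp_ofReal (f : ℂ → ℂ) (x : ℝ) : sharp f x = conj (f x) := by
  simp [sharp]

lemma IsHermiteBiehler.norm_sharp_lt (hE : IsHermiteBiehler E) {z : ℂ} (hz : 0 < z.im) :
    ‖sharp E z‖ < ‖E z‖ := by
  simpa [sharp] using hE.norm_conj_lt z hz

/-- The numerator of the reproducing kernel. -/
noncomputable def kernelNum (E : ℂ → ℂ) (w z : ℂ) : ℂ :=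
  conj (E w) * E z - E (conj w) * sharp E z

/-- The reproducing kernel `(conj (E w) E z - E (conj w) E^# z) / (2πi (conj w - z))`, as an entire
function of `z`. -/
noncomputable def kernelFun (E : ℂ → ℂ) (w z : ℂ) : ℂ :=
  -(2 * Real.pi * Complex.I)⁻¹ * dslope (kernelNum E w) (conj w) z

lemma kernelNum_conj (E : ℂ → ℂ) (w : ℂ) : kernelNum E w (conj w) = 0 := by
  simp [kernelNum, sharp, mul_comm]

lemma kernelFun_of_ne (E : ℂ → ℂ) {w z : ℂ} (h : z ≠ conj w) :
    kernelFun E w z = kernelNum E w z / (2 * Real.pi * Complex.I * (conj w - z)) := by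
  rw [kernelFun, dslope_of_ne _ h, slope_def_field, kernelNum_conj, sub_zero,
    ← neg_sub (conj w) z, div_neg, neg_mul_neg, inv_mul_eq_div, div_div, mul_comm (conj w - z)]

lemma differentiable_kernelNum (hE : Differentiable ℂ E) (w : ℂ) :
    Differentiable ℂ (kernelNum E w) :=
  (hE.const_mul _).sub ((differentiable_sharp hE).const_mul _)

lemma differentiable_kernelFun (hE : Differentiable ℂ E) (w : ℂ) :
    Differentiable ℂ (kernelFun E w) := by
  refine Differentiable.const_mul ?_ _
  rw [← differentiableOn_univ]
  exact (Complex.differentiableOn_dslope univ_mem).2 (differentiable_kernelNum hE w).differentiableOn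

/-- Reduces the `H²` condition on `k_w^#` to the one on a kernel. The quotient formula gives the
identity off `w`, and continuity extends it. -/
lemma sharp_kernelFun (hE : Differentiable ℂ E) (w : ℂ) :
    sharp (kernelFun E w) = kernelFun E (conj w) := by
  refine Continuous.ext_on (dense_compl_singleton w)
    (differentiable_sharp (differentiable_kernelFun hE w)).continuous
    (differentiable_kernelFun hE _).continuous fun z hz => ?_
  have h1 : z ≠ w := hz
  have h2 : conj z ≠ conj w := fun h => h1 ((starRingEnd ℂ).injective h)
  rw [sharp, kernelFun_of_ne E h2, kernelFun_of_ne E (by simpa using h1)]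
  simp only [kernelNum, sharp, map_div₀, map_sub, map_mul, Complex.conj_conj, Complex.conj_I,
    Complex.conj_ofReal, map_ofNat]
  rw [← neg_sub (E w * _), ← neg_div_neg_eq (-_)]
  ring

lemma memHardyTwo_kernelFun_div (hE : IsHermiteBiehler E) (w : ℂ) :
    MemHardyTwo fun z => kernelFun E w z / E z := by
  have hdiff : DifferentiableOn ℂ (fun z => kernelFun E w z / E z) {z | 0 < z.im} := fun z hz =>
    ((differentiable_kernelFun hE.differentiable w z).div (hE.differentiable z)
      (hE.ne_zero hz)).differentiableWithinAt
  have hfar : ∀ z : ℂ, 0 < z.im →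
      ‖kernelFun E w z / E z‖ * ‖z - conj w‖ ≤ (‖E w‖ + ‖E (conj w)‖) / (2 * Real.pi) := by
    intro z hz
    rcases eq_or_ne z (conj w) with rfl | hne
    · simp; positivity
    have hEz : 0 < ‖E z‖ := norm_pos_iff.2 (hE.ne_zero hz)
    have hN : ‖kernelNum E w z‖ ≤ (‖E w‖ + ‖E (conj w)‖) * ‖E z‖ := by
      calc ‖kernelNum E w z‖ ≤ ‖E w‖ * ‖E z‖ + ‖E (conj w)‖ * ‖sharp E z‖ := by
            refine (norm_sub_le _ _).trans ?_
            simp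
        _ ≤ ‖E w‖ * ‖E z‖ + ‖E (conj w)‖ * ‖E z‖ := by
            gcongr; exact (hE.norm_sharp_lt hz).le
        _ = _ := by ring
    have hzw : 0 < ‖z - conj w‖ := norm_pos_iff.2 (sub_ne_zero.2 hne)
    rw [kernelFun_of_ne E hne]
    simp only [norm_div, norm_mul, Complex.norm_I, Complex.norm_real, Complex.norm_ofNat, mul_one,
      Real.norm_of_nonneg Real.pi_pos.le]
    rw [norm_sub_rev (conj w) z]
    have := Real.pi_pos
    rw [div_div, div_mul_eq_mul_div, div_le_div_iff₀ (by positivity) (by positivity)]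
    calc ‖kernelNum E w z‖ * ‖z - conj w‖ * (2 * Real.pi)
        ≤ (‖E w‖ + ‖E (conj w)‖) * ‖E z‖ * ‖z - conj w‖ * (2 * Real.pi) := by gcongr
      _ = _ := by ring
  -- Only boundedness near `conj w` is left. It follows from continuity unless `E (conj w) = 0`;
  -- then either `w` is real and the numerator vanishes identically, or `conj w` is at distance
  -- `w.im` from the upper half-plane.
  by_cases h0 : E (conj w) = 0
  · have him : 0 ≤ w.im := by
      by_contra! h
      exact hE.ne_zero (z := conj w) (by simpa using h) h0
    rcases him.eq_or_lt with him | him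
    · have hw : conj w = w := Complex.conj_eq_iff_im.2 him.symm
      have hN : kernelNum E w = fun _ => 0 := by
        ext z
        simp [kernelNum, h0, hw ▸ h0]
      refine memHardyTwo_of_bounds (v := conj w) (δ := 1) (M := 0) hdiff one_pos
        (fun z hz _ => ?_) hfar
      rcases eq_or_ne z (conj w) with rfl | hne
      · simp [h0]
      · simp [kernelFun_of_ne E hne, hN]
    · refine memHardyTwo_of_bounds (v := conj w) (δ := w.im) (M := 0) hdiff him
        (fun z hz hlt => ?_) hfar
      have := Complex.abs_im_le_norm (z - conj w)
      rw [Complex.sub_im, Complex.conj_im, sub_neg_eq_add, abs_of_pos (by linarith)] at this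
      linarith
  · have hc : ContinuousAt (fun z => kernelFun E w z / E z) (conj w) :=
      (differentiable_kernelFun hE.differentiable w).continuous.continuousAt.div
        hE.differentiable.continuous.continuousAt h0
    obtain ⟨δ, hδ, hball⟩ := Metric.eventually_nhds_iff.1
      (hc.norm.eventually_lt_const (lt_add_one _))
    exact memHardyTwo_of_bounds hdiff hδ
      (fun z _ hlt => (hball (by rwa [dist_eq_norm])).le) hfar

/-- The reproducing kernel at `w`, as an element of `H(E)`. -/
noncomputable def kernel (hE : IsHermiteBiehler E) (w : ℂ) : Space E hE :=
  ⟨kernelFun E w, differentiable_kernelFun hE.differentiable w, memHardyTwo_kernelFun_div hE w, by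
    rw [sharp_kernelFun hE.differentiable]
    exact memHardyTwo_kernelFun_div hE _⟩

lemma kernel_apply (w z : ℂ) : kernel hE w z = kernelFun E w z := rfl

/-! ### The reproducing property -/

lemma ae_continuousAt_div (hE : IsHermiteBiehler E) {f : ℂ → ℂ} (hf : Differentiable ℂ f) :
    ∀ᵐ x : ℝ, ContinuousAt (fun z => f z / E z) x := by
  filter_upwards [hE.ae_ne_zero] with x hx
  exact hf.continuous.continuousAt.div hE.differentiable.continuous.continuousAt hx

lemma ofReal_ne_of_im_ne_zero {w : ℂ} (hw : w.im ≠ 0) (x : ℝ) : (x : ℂ) ≠ w := by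
  rintro rfl
  simp at hw

/-- On the real line `g = conj g^#`, so the second term of the kernel can be written with `g^# / E`,
which also belongs to `H²` when `g ∈ H(E)`. -/
lemma conj_kernelFun_mul_div {g : ℂ → ℂ} {w : ℂ} (hw : w.im ≠ 0) {x : ℝ} (hx : E x ≠ 0) :
    conj (kernelFun E w x) * g x / (‖E x‖ : ℂ) ^ 2 = (2 * Real.pi * Complex.I)⁻¹ *
      (E w * (g x / E x * ((x : ℂ) - w)⁻¹)
        - sharp E w * conj (sharp g x / E x * ((x : ℂ) - conj w)⁻¹)) := by
  have h1 : (x : ℂ) - w ≠ 0 := sub_ne_zero.2 (ofReal_ne_of_im_ne_zero hw x)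
  have h1' : w - (x : ℂ) ≠ 0 := sub_ne_zero.2 (ofReal_ne_of_im_ne_zero hw x).symm
  have h2 : (x : ℂ) ≠ conj w := ofReal_ne_of_im_ne_zero (by simpa using hw) x
  have h3 : conj (E x) ≠ 0 := by simpa using hx
  have hpi : (Real.pi : ℂ) ≠ 0 := by exact_mod_cast Real.pi_ne_zero
  rw [kernelFun_of_ne E h2, ← Complex.conj_mul', kernelNum, sharp_ofReal, sharp_ofReal, sharp]
  simp only [map_div₀, map_sub, map_mul, map_inv₀, Complex.conj_conj, Complex.conj_I,
    Complex.conj_ofReal, map_ofNat]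
  have hI := Complex.I_ne_zero
  rw [← neg_sub (x : ℂ) w]
  field_simp

/-- For `w` in the upper half-plane the Cauchy integral of `g / E` gives `g w / E w` and that of
`g^# / E`, taken at `conj w`, vanishes; in the lower half-plane the roles are exchanged. -/
lemma inner_kernel_of_im_ne_zero {w : ℂ} (hw : w.im ≠ 0) (g : Space E hE) :
    inner ℂ (kernel hE w) g = g w := by
  have hgc := ae_continuousAt_div hE g.differentiable
  have hgc' := ae_continuousAt_div hE (differentiable_sharp g.differentiable)
  have hg : MemHardyTwo fun z => g z / E z := g.2.2.1
  have hg' : MemHardyTwo fun z => sharp g z / E z := g.2.2.2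
  have hmem : ∀ v : ℂ, v.im ≠ 0 → MemLp (fun x : ℝ => ((x : ℂ) - v)⁻¹) 2 := by
    intro v hv
    rcases hv.lt_or_gt with hv | hv
    · exact memLp_inv_sub hv
    · have := (memLp_inv_sub (w := conj v) (by simpa using hv)).star
      refine this.ae_eq (Eventually.of_forall fun x => ?_)
      simp
  have hi1 : Integrable fun x : ℝ => g x / E x * ((x : ℂ) - w)⁻¹ :=
    (hg.memLp_boundary hgc).integrable_mul (hmem w hw)
  have hi2 : Integrable fun x : ℝ => conj (sharp g x / E x * ((x : ℂ) - conj w)⁻¹) :=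
    Complex.conjCLE.toContinuousLinearMap.integrable_comp
      ((hg'.memLp_boundary hgc').integrable_mul (hmem (conj w) (by simpa using hw)))
  have hint : inner ℂ (kernel hE w) g = (2 * Real.pi * Complex.I)⁻¹ *
      (E w * (∫ x : ℝ, g x / E x * ((x : ℂ) - w)⁻¹)
        - sharp E w * conj (∫ x : ℝ, sharp g x / E x * ((x : ℂ) - conj w)⁻¹)) := by
    rw [inner_def, ← integral_conj, ← integral_const_mul, ← integral_const_mul,
      ← integral_sub (hi1.const_mul _) (hi2.const_mul _), ← integral_const_mul]
    refine integral_congr_ae ?_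
    filter_upwards [hE.ae_ne_zero] with x hx
    exact conj_kernelFun_mul_div hw hx
  have hpi : (Real.pi : ℂ) ≠ 0 := by exact_mod_cast Real.pi_ne_zero
  have hI := Complex.I_ne_zero
  rw [hint]
  rcases hw.lt_or_gt with hw | hw
  · have hw' : 0 < (conj w).im := by simpa using hw
    rw [hg.integral_div_sub_eq_zero hgc hw, hg'.integral_div_sub hgc' hw']
    have hEw : conj (E (conj w)) ≠ 0 := by simpa using hE.ne_zero hw'
    simp only [sharp, map_div₀, map_mul, Complex.conj_conj, Complex.conj_I,
      Complex.conj_ofReal, map_ofNat]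
    field_simp
    ring
  · rw [hg.integral_div_sub hgc hw, hg'.integral_div_sub_eq_zero hgc' (by simpa using hw)]
    have hEw := hE.ne_zero hw
    simp only [map_zero, mul_zero, sub_zero]
    field_simp

lemma kernelFun_self_of_im_ne_zero {w : ℂ} (hw : w.im ≠ 0) :
    kernelFun E w w = ((‖E w‖ ^ 2 - ‖E (conj w)‖ ^ 2) / (4 * Real.pi * w.im) : ℝ) := by
  have hne : w ≠ conj w := fun h => hw (Complex.conj_eq_iff_im.1 h.symm)
  have hden : 2 * Real.pi * Complex.I * (conj w - w) = 4 * Real.pi * w.im := by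
    rw [← neg_sub, Complex.sub_conj]
    push_cast
    linear_combination (-4 * Real.pi * w.im : ℂ) * Complex.I_sq
  rw [kernelFun_of_ne E hne, hden, kernelNum, sharp, Complex.conj_mul', Complex.mul_conj']
  push_cast
  rfl

lemma kernelFun_self_ofReal (hE : Differentiable ℂ E) (x : ℝ) :
    kernelFun E x x = (-(deriv E x * conj (E x)).im / Real.pi : ℝ) := by
  have hd : deriv (kernelNum E x) x = conj (E x) * deriv E x - E x * conj (deriv E x) := by
    have h := ((hE x).hasDerivAt.const_mul (conj (E x))).sub
      ((differentiable_sharp hE x).hasDerivAt.const_mul (E (conj (x : ℂ))))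
    rw [deriv_sharp, Complex.conj_ofReal] at h
    have hfun : kernelNum E x = (fun z => conj (E x) * E z) - fun z => E x * sharp E z := by
      ext z
      simp [kernelNum]
    rw [hfun]
    exact h.deriv
  have him : conj (E x) * deriv E x - E x * conj (deriv E x)
      = (2 * (deriv E x * conj (E x)).im : ℝ) * Complex.I := by
    rw [← Complex.sub_conj]
    simp [mul_comm]
  rw [kernelFun, Complex.conj_ofReal, dslope_same, hd, him]
  have hpi : (Real.pi : ℂ) ≠ 0 := by exact_mod_cast Real.pi_ne_zero
  have hI := Complex.I_ne_zero
  push_cast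
  field_simp

lemma inner_self_eq_ofReal (f : Space E hE) : inner ℂ f f = ((‖f‖ ^ 2 : ℝ) : ℂ) := by
  rw [inner_self_eq_norm_sq_to_K]
  push_cast
  rfl

lemma norm_sq_eq_integral (f : Space E hE) : ‖f‖ ^ 2 = ∫ t : ℝ, ‖f t‖ ^ 2 / ‖E t‖ ^ 2 := by
  have h := inner_self_eq_ofReal f
  have h2 : inner ℂ f f = ((∫ t : ℝ, ‖f t‖ ^ 2 / ‖E t‖ ^ 2 : ℝ) : ℂ) := innerProd_self f
  rw [h2] at h
  exact_mod_cast h.symm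

lemma lintegral_enorm_div_sq (f : Space E hE) :
    ∫⁻ t : ℝ, ‖f t / E t‖ₑ ^ 2 = ENNReal.ofReal (‖f‖ ^ 2) := by
  rw [norm_sq_eq_integral, ofReal_integral_eq_lintegral_ofReal (integrable_normSq f)
    (Eventually.of_forall fun t => by positivity)]
  refine lintegral_congr fun t => ?_
  rw [← ofReal_norm, ← ENNReal.ofReal_pow (by positivity), norm_div, div_pow]

lemma norm_kernel_sq_of_im_ne_zero {w : ℂ} (hw : w.im ≠ 0) :
    ‖kernel hE w‖ ^ 2 = (‖E w‖ ^ 2 - ‖E (conj w)‖ ^ 2) / (4 * Real.pi * w.im) := by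
  have h := inner_self_eq_ofReal (kernel hE w)
  rw [inner_kernel_of_im_ne_zero hw, kernel_apply, kernelFun_self_of_im_ne_zero hw] at h
  exact_mod_cast h.symm

/-- The norms of the kernels stay bounded along a vertical approach to the real line. -/
lemma exists_norm_kernel_sq_le (hE : IsHermiteBiehler E) (x : ℝ) : ∃ B : ℝ, ∀ n : ℕ,
    ‖kernel hE (x + (1 / ((n : ℝ) + 1) : ℝ) * Complex.I)‖ ^ 2 ≤ B := by
  -- The squared norm at height `y` is `q y / y / (4 * π)`, a difference quotient of `q` at `0`,
  -- hence convergent along the sequence.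
  set q : ℝ → ℝ := fun y => ‖E (x + y * Complex.I)‖ ^ 2 - ‖E (x - y * Complex.I)‖ ^ 2 with hq
  have hEr : Differentiable ℝ E := hE.differentiable.restrictScalars ℝ
  have hd : DifferentiableAt ℝ q 0 := by
    have hc : Differentiable ℝ fun y : ℝ => (y : ℂ) := Complex.ofRealCLM.differentiable
    have h1 : Differentiable ℝ fun y : ℝ => E (x + y * Complex.I) :=
      hEr.comp ((hc.mul_const _).const_add _)
    have h2 : Differentiable ℝ fun y : ℝ => E (x - y * Complex.I) :=
      hEr.comp ((hc.mul_const _).const_sub _)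
    exact ((h1 0).norm_sq ℝ).sub ((h2 0).norm_sq ℝ)
  have hq0 : q 0 = 0 := by simp [hq]
  have hlim : Tendsto (fun n : ℕ => slope q 0 (1 / ((n : ℝ) + 1))) atTop (𝓝 (deriv q 0)) := by
    refine hd.hasDerivAt.tendsto_slope.comp (tendsto_nhdsWithin_iff.2
      ⟨tendsto_one_div_add_atTop_nhds_zero_nat, Eventually.of_forall fun n => ?_⟩)
    have : (0 : ℝ) < 1 / ((n : ℝ) + 1) := by positivity
    exact this.ne'
  obtain ⟨B, hB⟩ := hlim.bddAbove_range
  refine ⟨B / (4 * Real.pi), fun n => ?_⟩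
  have hy : (0 : ℝ) < 1 / ((n : ℝ) + 1) := by positivity
  have hB' := hB ⟨n, rfl⟩
  have hpi := Real.pi_pos
  simp only [slope_def_field, hq0, sub_zero] at hB'
  set y : ℝ := 1 / ((n : ℝ) + 1)
  have him : ((x : ℂ) + y * Complex.I).im = y := by simp
  have hconj : conj ((x : ℂ) + y * Complex.I) = x - y * Complex.I := by simp [sub_eq_add_neg]
  rw [norm_kernel_sq_of_im_ne_zero (by rw [him]; exact hy.ne'), him, hconj]
  calc _ = q y / y / (4 * Real.pi) := by rw [div_div, mul_comm y]
    _ ≤ _ := by gcongr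

/-- The reproducing property of the kernels. -/
lemma inner_kernel (w : ℂ) (g : Space E hE) : inner ℂ (kernel hE w) g = g w := by
  by_cases hw : w.im = 0
  swap
  · exact inner_kernel_of_im_ne_zero hw g
  obtain ⟨x, rfl⟩ : ∃ x : ℝ, w = x := ⟨w.re, Complex.ext (by simp) (by simp [hw])⟩
  set v : ℕ → ℂ := fun n => x + (1 / ((n : ℝ) + 1) : ℝ) * Complex.I with hv
  have hvim : ∀ n, (v n).im ≠ 0 := fun n => by
    have : (0 : ℝ) < 1 / ((n : ℝ) + 1) := by positivity
    have him : (v n).im = 1 / ((n : ℝ) + 1) := by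
      simp only [hv, Complex.add_im, Complex.ofReal_im, Complex.im_ofReal_mul, Complex.I_im,
        mul_one, zero_add]
    rw [him]
    exact this.ne'
  have hvx : Tendsto v atTop (𝓝 x) := tendsto_line_boundary (F := id) continuousAt_id
  have hrw : ∀ f : Space E hE, inner ℂ f g = ∫ t : ℝ, conj (f t / E t) * (g t / E t) := fun f => by
    rw [inner_def]
    congr 1
    ext t
    rw [map_div₀, div_mul_div_comm, Complex.conj_mul']
  obtain ⟨B, hB⟩ := exists_norm_kernel_sq_le hE x
  -- Bounded norms and convergence almost everywhere on the line give weak convergence of the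
  -- kernels at `v n`.
  have hlim : Tendsto (fun n => inner ℂ (kernel hE (v n)) g) atTop
      (𝓝 (inner ℂ (kernel hE x) g)) := by
    simp only [hrw]
    refine tendsto_integral_mul_of_bounded (C := B.toNNReal)
      (fun n => (kernel hE (v n)).memLp.star.1) (fun n => ?_) (kernel hE x).memLp.star g.memLp ?_
    · have := lintegral_enorm_div_sq (kernel hE (v n))
      simp only [RCLike.enorm_conj, this]
      exact ENNReal.ofReal_le_ofReal (hB n)
    · have hx : ∀ᵐ t : ℝ, t ≠ x := by simp [ae_iff]
      filter_upwards [hx] with t ht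
      have ht' : (t : ℂ) ≠ conj (x : ℂ) := by simpa using ht
      have htn : ∀ n, (t : ℂ) ≠ conj (v n) := fun n =>
        ofReal_ne_of_im_ne_zero (by simpa using hvim n) t
      have hvc : Tendsto (fun n => conj (v n)) atTop (𝓝 (conj (x : ℂ))) :=
        (Complex.continuous_conj.tendsto _).comp hvx
      have hEc := hE.differentiable.continuous
      have hN : Tendsto (fun n => kernelNum E (v n) t) atTop (𝓝 (kernelNum E x t)) :=
        (((Complex.continuous_conj.tendsto _).comp ((hEc.tendsto _).comp hvx)).mul_const _).sub
          (((hEc.tendsto _).comp hvc).mul_const _)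
      have hpi : (2 * Real.pi * Complex.I : ℂ) ≠ 0 := by simp [Real.pi_ne_zero]
      have hk : Tendsto (fun n => kernelFun E (v n) t) atTop (𝓝 (kernelFun E x t)) := by
        simp only [kernelFun_of_ne E ht', kernelFun_of_ne E (htn _)]
        exact hN.div ((hvc.sub_const _).const_mul _)
          (mul_ne_zero hpi (sub_ne_zero.2 ht'.symm))
      exact (Complex.continuous_conj.tendsto _).comp (hk.div_const _)
  refine tendsto_nhds_unique hlim ?_
  simp only [inner_kernel_of_im_ne_zero (hvim _)]
  exact (g.differentiable.continuous.tendsto _).comp hvx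

/-! ### Kernels at the real zeros of `A` -/

lemma norm_kernel_sq_ofReal (x : ℝ) :
    ‖kernel hE x‖ ^ 2 = -(deriv E x * conj (E x)).im / Real.pi := by
  have h := inner_self_eq_ofReal (kernel hE x)
  rw [inner_kernel, kernel_apply, kernelFun_self_ofReal hE.differentiable] at h
  exact_mod_cast h.symm

lemma kernelFun_self (w : ℂ) : kernelFun E w w = (‖kernel hE w‖ : ℂ) ^ 2 := by
  rw [← kernel_apply (hE := hE), ← inner_kernel w (kernel hE w)]
  exact inner_self_eq_norm_sq_to_K (𝕜 := ℂ) (kernel hE w)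

/-- If the kernel vanished at `i`, its numerator would force `‖E i‖ = ‖E^# i‖`, against the
Hermite–Biehler inequality. -/
lemma kernel_ne_zero {x : ℝ} (hx : E x ≠ 0) : kernel hE x ≠ 0 := by
  intro h
  have hI : Complex.I ≠ conj (x : ℂ) := by
    rw [Complex.conj_ofReal]
    exact (ofReal_ne_of_im_ne_zero (by simp) x).symm
  have h1 : kernelFun E x Complex.I = 0 := by
    rw [← kernel_apply (hE := hE), h, zero_apply]
  have hpi : (2 * Real.pi * Complex.I : ℂ) ≠ 0 := by simp [Real.pi_ne_zero]
  rw [kernelFun_of_ne E hI, div_eq_zero_iff,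
    or_iff_left (mul_ne_zero hpi (sub_ne_zero.2 hI.symm)), kernelNum, sub_eq_zero,
    Complex.conj_ofReal] at h1
  have h2 := congrArg norm h1
  rw [norm_mul, norm_mul, RCLike.norm_conj] at h2
  exact (hE.norm_sharp_lt (z := Complex.I) (by simp)).ne'
    (mul_left_cancel₀ (norm_ne_zero_iff.2 hx) h2)

lemma re_eq_zero_of_partA_eq_zero {x : ℝ} (hx : partA E x = 0) : (E x).re = 0 := by
  have := congrArg Complex.re hx
  simp [partA, sharp] at this
  linarith

/-- Both values of `E` are purely imaginary, so conjugation changes their sign and the two terms of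
the numerator cancel. -/
lemma kernelFun_eq_zero_of_partA_eq_zero {x y : ℝ} (hx : partA E x = 0) (hy : partA E y = 0)
    (hxy : x ≠ y) : kernelFun E x y = 0 := by
  have h : ∀ s : ℝ, partA E s = 0 → conj (E s) = -E s := fun s hs => by
    apply Complex.ext <;> simp [re_eq_zero_of_partA_eq_zero hs]
  rw [kernelFun_of_ne E (by simpa using hxy.symm), kernelNum, sharp_ofReal, Complex.conj_ofReal,
    h x hx, h y hy]
  simp

/-- With `E x = iβ` the squared norm of `k_x` is `β * Re (E' x) / π`; the two branches are the
nonreal and real formulas for the norm at `φ x`. -/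
lemma kernelRatio_re (hE : IsHermiteBiehler E) (φ : ℂ → ℂ) {x : ℝ} (hx : partA E x = 0) :
    (kernelRatio E φ x).re = ‖kernel hE (φ x)‖ ^ 2 / ‖kernel hE x‖ ^ 2 := by
  obtain ⟨β, hβ⟩ : ∃ β : ℝ, E x = β * Complex.I :=
    ⟨(E x).im, by apply Complex.ext <;> simp [re_eq_zero_of_partA_eq_zero hx]⟩
  have hpi := Real.pi_ne_zero
  have hk : ‖kernel hE x‖ ^ 2 = β * (deriv E x).re / Real.pi := by
    rw [norm_kernel_sq_ofReal, hβ]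
    simp [mul_comm]
  rw [hk, kernelRatio, hβ]
  split_ifs with h
  · rw [norm_kernel_sq_of_im_ne_zero h]
    have hden : -4 * Complex.I * ((φ x).im : ℂ) * (β * Complex.I) * ((deriv E x).re : ℂ)
        = ((4 * (φ x).im * β * (deriv E x).re : ℝ) : ℂ) := by
      push_cast
      linear_combination (-4 * (φ x).im * β * (deriv E x).re : ℂ) * Complex.I_sq
    rw [hden]
    norm_cast
    field_simp
  · obtain ⟨s, hs⟩ : ∃ s : ℝ, φ x = s :=
      ⟨(φ x).re, Complex.ext (by simp) (by simpa using h)⟩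
    have hden : ∀ a : ℝ, -Complex.I * (a : ℂ) / (β * Complex.I * ((deriv E x).re : ℂ))
        = ((-a / (β * (deriv E x).re) : ℝ) : ℂ) := fun a => by
      rw [show -Complex.I * (a : ℂ) = Complex.I * (-a) by ring,
        show β * Complex.I * ((deriv E x).re : ℂ) = Complex.I * (β * (deriv E x).re) by ring,
        mul_div_mul_left _ _ Complex.I_ne_zero]
      push_cast; rfl
    rw [hden, Complex.ofReal_re, hs, norm_kernel_sq_ofReal, div_div_div_cancel_right₀ hpi]

/-- The normalized kernels at distinct real zeros of `A` are orthonormal. -/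
lemma orthonormal_kernel (hE : IsHermiteBiehler E) {t : ℕ → ℝ} (ht : Function.Injective t)
    (hA : ∀ n, partA E (t n) = 0) (hne : ∀ n, E (t n) ≠ 0) :
    Orthonormal ℂ fun n => ((‖kernel hE (t n)‖⁻¹ : ℝ) : ℂ) • kernel hE (t n) := by
  refine ⟨fun n => ?_, fun m n hmn => ?_⟩
  · rw [norm_smul, Complex.norm_real, norm_inv, norm_norm,
      inv_mul_cancel₀ (norm_ne_zero_iff.2 (kernel_ne_zero (hne n)))]
  · beta_reduce
    rw [inner_smul_left, inner_smul_right, inner_kernel, kernel_apply,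
      kernelFun_eq_zero_of_partA_eq_zero (hA n) (hA m) (ht.ne hmn.symm)]
    simp

end DeBranges

/-! ### Noncompactness -/

theorem theorem3p6 (E φ : ℂ → ℂ) (hE : DeBranges.IsHermiteBiehler E) (hφ : Differentiable ℂ φ)
    (T : DeBranges.Space E hE →L[ℂ] DeBranges.Space E hE)
    (hT : DeBranges.IsCompositionOperator φ T)
    (t : ℕ → ℝ) (ht_inj : Function.Injective t)
    (ht_range : Set.range t = {x : ℝ | DeBranges.partA E x = 0 ∧ E x ≠ 0})
    (d : ℝ) (hd : 0 < d)
    (hlimsup : (d : EReal) ≤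
      limsup (fun n : ℕ => (((DeBranges.kernelRatio E φ (t n)).re : ℝ) : EReal)) atTop) :
    ¬ IsCompactOperator T := by
  intro hcomp
  have ht : ∀ n, DeBranges.partA E (t n) = 0 ∧ E (t n) ≠ 0 := fun n =>
    ht_range.subset ⟨n, rfl⟩
  -- A level strictly below `d` is exceeded by `r_n` for infinitely many `n`; its square root is the
  -- `ε` of the compactness estimate.
  have hlt : ((d / 2 : ℝ) : EReal) < d := by exact_mod_cast half_lt_self hd
  have hfreq := frequently_lt_of_lt_limsup (by isBoundedDefault) (hlt.trans_le hlimsup)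
  have hsmall := DeBranges.eventually_norm_inner_le_of_isCompactOperator hcomp
    (DeBranges.orthonormal_kernel hE ht_inj (fun n => (ht n).1) fun n => (ht n).2)
    (Real.sqrt_pos.2 (half_pos hd))
  obtain ⟨n, hn1, hn2⟩ := (hfreq.and_eventually hsmall).exists
  rw [EReal.coe_lt_coe_iff, DeBranges.kernelRatio_re hE φ (ht n).1] at hn1
  -- For this test vector the inner product has modulus `a ^ 2 / b` and the vector has norm `a`, so
  -- the estimate becomes `a / b ≤ √(d / 2)` once `a > 0`.
  have h := hn2 (DeBranges.kernel hE (φ (t n)))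
  have hk : 0 < ‖DeBranges.kernel hE (t n)‖ := norm_pos_iff.2 (DeBranges.kernel_ne_zero (ht n).2)
  rw [inner_smul_left, DeBranges.inner_kernel, hT, DeBranges.kernel_apply,
    DeBranges.kernelFun_self (hE := hE), Complex.conj_ofReal, norm_mul, norm_pow,
    Complex.norm_real, Complex.norm_real, norm_inv, norm_norm, norm_norm] at h
  set a := ‖DeBranges.kernel hE (φ (t n))‖
  set b := ‖DeBranges.kernel hE (t n)‖
  have ha : 0 < a := by
    rcases (norm_nonneg (DeBranges.kernel hE (φ (t n)))).eq_or_lt with h0 | h0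
    · have : a = 0 := h0.symm
      rw [this] at hn1
      simp at hn1
      linarith
    · exact h0
  have h1 : a / b ≤ √(d / 2) := by
    refine le_of_mul_le_mul_right ?_ ha
    calc a / b * a = b⁻¹ * a ^ 2 := by ring
      _ ≤ _ := h
  have h2 : (a / b) ^ 2 ≤ d / 2 := by
    rw [← Real.sq_sqrt (half_pos hd).le]
    gcongr
  rw [div_pow] at h2
  linarith
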